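/- An inversion sequence of length $n$ is an integer sequence $e=(e_1,\dots,e_n)$ with $0\le e_j\le j-1$ for all $j$. It contains a pattern $w$ of length $k$ if for some $i_1<\dots<i_k$ the word obtained from $e_{i_1}\cdots e_{i_k}$ by replacing each occurrence of its $r$-th smallest distinct value by $r-1$ equals $w$; otherwise it avoids $w$. For $n\ge 1$, let $p$ be the position of the first descent of $e$, i.e. $e_1\le e_2\le\dots\le e_p>e_{p+1}$ with the convention $e_{n+1}=-1$; for a $102$-avoiding inversion sequence $e$ one defines $\operatorname{rank}(e)=p-\max(e)-1$. For integers $j\ge 0$ and $k\ge 1$ let $$c(j,k):=\frac{k}{2j+k}\binom{2j+k}{j}.$$ Then $c(j,k)=[x^j]\,C(x)^k$, where $C(x)=\sum_{m\ge0}\frac{1}{m+1}\binom{2m}{m}x^m$ is the generating function of the Catalan numbers. Moreover, for all integers $n\ge 2$ and $0\le t\le n-1$, the number of inversion sequences $e$ of length $n$ that avoid both $102$ and $210$ and have $\operatorname{rank}(e)=t$ equals $$c(n-t-1,t+1)+(t+1)\sum_{i=0}^{n-t-3}\binom{2i+t+3}{i}+\sum_{i=0}^{n-t-4}\bigl(c(i,t+6)-c(i,5)\bigr),$$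 where a sum whose upper limit is negative is $0$. -/

import Mathlib

namespace InvSeq

/-- Inversion sequences of length `n`. The entry at (1-based) position `j` is `e ⟨j - 1, _⟩`,
so the condition `0 ≤ e_j ≤ j - 1` reads `e i < i + 1` for the 0-based index `i`. -/
def inversionSequences (n : ℕ) : Finset (Fin n → ℕ) :=
  Fintype.piFinset fun i : Fin n => Finset.range ((i : ℕ) + 1)

/-- The reduction of a word: each entry is replaced by the number of distinct smaller values
in the word (the `i`-th smallest value becomes `i - 1`). -/
def reduction {k : ℕ} (w : Fin k → ℕ) : Fin k → ℕ :=
  fun i => ((Finset.univ.image w).filter (fun v => v < w i)).card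

/-- `e` contains the pattern `w`: some subsequence of `e` has reduction `w`. -/
def Contains {n k : ℕ} (e : Fin n → ℕ) (w : Fin k → ℕ) : Prop :=
  ∃ f : Fin k → Fin n, StrictMono f ∧ reduction (fun i => e (f i)) = w

/-- `e` avoids the pattern `w`. -/
def Avoids {n k : ℕ} (e : Fin n → ℕ) (w : Fin k → ℕ) : Prop :=
  ¬ Contains e w

/-- The entry of `e` at the 1-based position `p`, with the convention that the entry
at position `n + 1` is `-1`. -/
def entry {n : ℕ} (e : Fin n → ℕ) (p : ℕ) : ℤ :=
  if h : 1 ≤ p ∧ p ≤ n then (e ⟨p - 1, by omega⟩ : ℤ) else -1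

/-- The 1-based position of the first descent of `e` (where `e_{n+1} = -1`, so that for `n ≥ 1`
there always is one): the least `p` in `{1, …, n}` with `e_p > e_{p+1}`. -/
noncomputable def prmx {n : ℕ} (e : Fin n → ℕ) : ℕ :=
  sInf {p : ℕ | 1 ≤ p ∧ p ≤ n ∧ entry e (p + 1) < entry e p}

/-- The largest entry of `e`. -/
def maxEntry {n : ℕ} (e : Fin n → ℕ) : ℕ :=
  Finset.univ.sup e

/-- The rank of a sequence. -/
noncomputable def rank {n : ℕ} (e : Fin n → ℕ) : ℤ :=
  (prmx e : ℤ) - (maxEntry e : ℤ) - 1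

open Classical in
/-- The `(102, 210)`-avoiding inversion sequences of length `n` with rank `t`. -/
noncomputable def avoiders102And210 (n t : ℕ) : Finset (Fin n → ℕ) :=
  (inversionSequences n).filter fun e =>
    Avoids e ![1, 0, 2] ∧ Avoids e ![2, 1, 0] ∧ rank e = (t : ℤ)

/-- `c(j, k) = k / (2j + k) * binom(2j + k, j)`, used for `k ≥ 1`. -/
def c (j k : ℕ) : ℚ :=
  (k : ℚ) / (2 * (j : ℚ) + (k : ℚ)) * ((2 * j + k).choose j : ℚ)

end InvSeq

/-! Cut an avoider after its first descent position `p`. The prefix `a` is weakly increasing, and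
avoiding 102 keeps every later entry weakly below its last entry, so that entry is the maximum `m`;
rank `t` means `p = m + t + 1`. If the suffix is nonempty and starts with `x < m`, let `y` be the
least entry of `a` exceeding `x`. Avoiding 102 bounds the suffix by `y`, and avoiding 210 makes its
letters below `m` weakly increasing. So after `x` comes a weakly increasing word over `[x, y]` if `y
< m`, and such a word over `[x, m)` with copies of `m` inserted freely if `y = m`
(`append_mem_avoiders`, `isTail_cons_iff`). Both families have rational generating functions by
length, products of geometric factors (`shuffleSeries_succ`).

With `t` fixed and `j = n - t - 1`, summing over `m` becomes a diagonal sum `∑ X^m f m`. Extending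
prefixes by one entry gives recurrences for their number `N`, their total tail weight `S`, and an
auxiliary weight `SB` that treats no value as the maximum. With `C` the Catalan series and `B_k = ∑
binom(2i + k, i) X^i`, these solve to `∑ N = C^(t+1)`, `(1 - X) ∑ SB = (t+1) X B_(t+3)` and `(1 - X)
∑ (S - SB) = X^2 C^5 (C^(t+1) - 1)` (`diagSum_prefix`, `one_sub_X_mul_diagSum_lower`,
`diagSum_difference`). Dividing by `1 - X` produces the partial sums in the formula. -/

namespace InvSeq

open PowerSeries Finset

/-! ### Catalan series, uniqueness of solutions, coefficients of powers -/

/-- The generating function of the Catalan numbers with rational coefficients. -/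
noncomputable def catSeries : PowerSeries ℚ :=
  PowerSeries.map (Nat.castRingHom ℚ) catalanSeries

theorem catSeries_eq : catSeries = 1 + X * catSeries ^ 2 := by
  have h := congrArg (PowerSeries.map (Nat.castRingHom ℚ)) catalanSeries_sq_mul_X_add_one
  simp only [map_add, map_mul, map_pow, map_X, map_one] at h
  rw [← catSeries] at h
  linear_combination -h

theorem constantCoeff_catSeries : constantCoeff catSeries = 1 := by
  rw [catSeries_eq]; simp

theorem catSeries_ne_zero : catSeries ≠ 0 := by
  intro h
  have := constantCoeff_catSeries
  simp [h] at this

theorem eq_zero_of_forall_X_pow_dvd {f : PowerSeries ℚ} (h : ∀ n, X ^ n ∣ f) : f = 0 := by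
  ext j
  have := X_pow_dvd_iff.1 (h (j + 1)) j (Nat.lt_succ_self j)
  simpa using this

/-- A solution of the second order recurrence `F (k + 1) = F k + X * F (k + 2) + H k` is determined
by its initial value. -/
theorem eq_of_recurrence {F G H : ℕ → PowerSeries ℚ} (h0 : F 0 = G 0)
    (hF : ∀ k, F (k + 1) = F k + X * F (k + 2) + H k)
    (hG : ∀ k, G (k + 1) = G k + X * G (k + 2) + H k) (k : ℕ) : F k = G k := by
  rw [← sub_eq_zero]
  apply eq_zero_of_forall_X_pow_dvd
  intro n
  induction n generalizing k with
  | zero => simp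
  | succ n ih =>
    induction k with
    | zero => simp [h0]
    | succ k ihk =>
      -- The term at `k + 2` gains its extra factor `X` explicitly, the term at `k` by the inner
      -- induction.
      have : F (k + 1) - G (k + 1) = (F k - G k) + X * (F (k + 2) - G (k + 2)) := by
        rw [hF, hG]; ring
      rw [this, pow_succ']
      exact dvd_add (by rw [← pow_succ']; exact ihk) (mul_dvd_mul_left _ (ih _))

/-- A solution of `P * F k = G k + X * A * F (k + 1)` is unique if `P` is a unit. -/
theorem eq_of_contraction {P A : PowerSeries ℚ} (hP : constantCoeff P = 1)
    {F G H : ℕ → PowerSeries ℚ}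
    (hF : ∀ k, P * F k = X * A * F (k + 1) + H k)
    (hG : ∀ k, P * G k = X * A * G (k + 1) + H k) (k : ℕ) : F k = G k := by
  rw [← sub_eq_zero]
  apply eq_zero_of_forall_X_pow_dvd
  intro n
  induction n generalizing k with
  | zero => simp
  | succ n ih =>
    have hu : IsUnit P := isUnit_iff_constantCoeff.2 (by simp [hP])
    have : P * (F k - G k) = X * (A * (F (k + 1) - G (k + 1))) := by
      rw [mul_sub, hF, hG]; ring
    rw [← hu.dvd_mul_left, this, pow_succ']
    exact mul_dvd_mul_left _ ((ih _).mul_left _)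

theorem catSeries_pow_recurrence (k : ℕ) :
    catSeries ^ (k + 1) = catSeries ^ k + X * catSeries ^ (k + 2) := by
  have h := catSeries_eq
  linear_combination catSeries ^ k * h

theorem c_zero {k : ℕ} (hk : 1 ≤ k) : c 0 k = 1 := by
  have : (k : ℚ) ≠ 0 := by positivity
  simp [c, this]

/-- The convolution formula `c(j, k) = k / j * binom(2j + k - 1, j - 1)`. -/
theorem succ_mul_c_succ (j k : ℕ) :
    ((j : ℚ) + 1) * c (j + 1) k = k * ((2 * j + (k + 1)).choose j : ℚ) := by
  have h := Nat.add_one_mul_choose_eq (2 * j + (k + 1)) j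
  have h' : ((2 * j + (k + 1) : ℚ) + 1) * ((2 * j + (k + 1)).choose j : ℚ) =
      ((2 * j + (k + 1) + 1).choose (j + 1) : ℚ) * (j + 1) := by exact_mod_cast h
  have e : 2 * (j + 1) + k = 2 * j + (k + 1) + 1 := by ring
  rw [c, e]
  have : (2 * ((j + 1 : ℕ) : ℚ) + k) ≠ 0 := by positivity
  field_simp
  push_cast
  linear_combination -(k : ℚ) * h'

/-- After clearing denominators this is Pascal's rule (`p`) together with the ratio of adjacent
binomials (`q`). -/
theorem c_recurrence (j k : ℕ) : c (j + 1) (k + 1) = c (j + 1) k + c j (k + 2) := by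
  rcases j with _ | j
  · have h1 := succ_mul_c_succ 0 (k + 1)
    have h2 := succ_mul_c_succ 0 k
    rw [c_zero (by omega)]
    simp at h1 h2 ⊢
    rw [h1, h2]
  · have h1 := succ_mul_c_succ (j + 1) (k + 1)
    have h2 := succ_mul_c_succ (j + 1) k
    have h3 := succ_mul_c_succ j (k + 2)
    have p : ((2 * (j + 1) + (k + 1 + 1)).choose (j + 1) : ℚ) =
        (2 * j + (k + 2 + 1)).choose j + (2 * (j + 1) + (k + 1)).choose (j + 1) := by
      have : 2 * (j + 1) + (k + 1 + 1) = (2 * j + (k + 2 + 1)) + 1 := by ring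
      have e : 2 * (j + 1) + (k + 1) = 2 * j + (k + 2 + 1) := by ring
      rw [this, e, Nat.choose_succ_succ]; push_cast; ring
    have q : ((2 * (j + 1) + (k + 1)).choose (j + 1) : ℚ) * (j + 1) =
        (2 * j + (k + 2 + 1)).choose j * (j + k + 3) := by
      have e : 2 * (j + 1) + (k + 1) = 2 * j + (k + 2 + 1) := by ring
      have h := Nat.choose_succ_right_eq (2 * j + (k + 2 + 1)) j
      rw [e]
      have e2 : 2 * j + (k + 2 + 1) - j = j + k + 3 := by omega
      rw [e2] at h
      exact_mod_cast h
    rw [p] at h1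
    push_cast at h1 h2 h3
    have hj1 : (j : ℚ) + 1 ≠ 0 := by positivity
    have hj2 : (j : ℚ) + 1 + 1 ≠ 0 := by positivity
    have hz : ((j : ℚ) + 1) * (j + 1 + 1) ≠ 0 := mul_ne_zero hj1 hj2
    apply mul_left_cancel₀ hz
    linear_combination (j + 1 : ℚ) * h1 - (j + 1 : ℚ) * h2 - (j + 1 + 1 : ℚ) * h3 + q

theorem coeff_catSeries_pow (j k : ℕ) (hk : 1 ≤ k) : coeff j (catSeries ^ k) = c j k := by
  -- For positive index the identity includes `k = 0`, where both sides vanish, so the induction on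
  -- `k` can start there. Only `c 0 0 = 0` (division by zero) differs from the coefficient `1`.
  have : ∀ j k, coeff (j + 1) (catSeries ^ k) = c (j + 1) k := by
    intro j
    induction j with
    | zero =>
      intro k
      induction k with
      | zero => simp [c, coeff_one]
      | succ k ih =>
        rw [catSeries_pow_recurrence, map_add, coeff_succ_X_mul, ih, c_recurrence, c_zero (by omega),
          coeff_zero_eq_constantCoeff_apply, map_pow, constantCoeff_catSeries, one_pow]
    | succ j ihj =>
      intro k
      induction k with
      | zero => simp [c, coeff_one]
      | succ k ih =>
        rw [catSeries_pow_recurrence, map_add, coeff_succ_X_mul, ih, c_recurrence, ihj]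
  rcases j with _ | j
  · rw [c_zero hk, coeff_zero_eq_constantCoeff_apply, map_pow, constantCoeff_catSeries, one_pow]
  · exact this j k

/-! ### Binomial series and their relation to the Catalan series -/

/-- The series `∑ binom(2i + k, i) X^i`. -/
noncomputable def chooseSeries (k : ℕ) : PowerSeries ℚ :=
  PowerSeries.mk fun i => ((2 * i + k).choose i : ℚ)

theorem chooseSeries_recurrence (k : ℕ) :
    chooseSeries (k + 1) = chooseSeries k + X * chooseSeries (k + 2) := by
  ext j
  rcases j with _ | j
  · simp [chooseSeries]
  · rw [map_add, coeff_succ_X_mul]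
    simp only [chooseSeries, coeff_mk]
    have e1 : 2 * (j + 1) + (k + 1) = (2 * j + (k + 2)) + 1 := by ring
    have e2 : 2 * (j + 1) + k = 2 * j + (k + 2) := by ring
    rw [e1, e2, Nat.choose_succ_succ]; push_cast; ring

theorem chooseSeries_eq (k : ℕ) : chooseSeries k = catSeries ^ k * chooseSeries 0 :=
  eq_of_recurrence (F := chooseSeries) (G := fun k => catSeries ^ k * chooseSeries 0)
    (H := fun _ => 0) (by simp)
    (fun k => by rw [add_zero]; exact chooseSeries_recurrence k)
    (fun k => by simp only [catSeries_pow_recurrence k]; ring) k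

theorem X_mul_derivative_catSeries_pow (k : ℕ) :
    X * derivative ℚ (catSeries ^ k) = (k : PowerSeries ℚ) * X * chooseSeries (k + 1) := by
  ext j
  rcases j with _ | j
  · simp [mul_assoc]
  · rw [coeff_succ_X_mul, coeff_derivative, mul_assoc, ← map_natCast (PowerSeries.C (R := ℚ)) k,
      coeff_C_mul, coeff_succ_X_mul, chooseSeries, coeff_mk, ← succ_mul_c_succ, mul_comm]
    congr 1
    rcases k with _ | k
    · simp [c, coeff_one]
    · exact coeff_catSeries_pow _ _ (by omega)

/-- Differentiate `C = 1 + X C^2` and insert `C' = C^2 B`, where `B = chooseSeries 0`: this gives `B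
= 1 + 2 X C B`, and multiplying by `C` eliminates `X`. -/
theorem chooseSeries_zero_mul : chooseSeries 0 * (2 - catSeries) = catSeries := by
  have h1 := X_mul_derivative_catSeries_pow 1
  rw [pow_one, chooseSeries_eq 2, Nat.cast_one, one_mul] at h1
  have h2 := mul_left_cancel₀ X_ne_zero h1
  have h3 := congrArg (derivative ℚ) catSeries_eq
  rw [map_add, Derivation.leibniz, derivative_pow, derivative_X, Derivation.map_one_eq_zero] at h3
  simp only [smul_eq_mul] at h3
  rw [h2] at h3
  have hC := catSeries_eq
  have h4 : catSeries ^ 2 * (chooseSeries 0 * (2 - catSeries)) = catSeries ^ 2 * catSeries := by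
    push_cast at h3
    linear_combination catSeries * h3 - 2 * catSeries ^ 2 * chooseSeries 0 * hC
  exact mul_left_cancel₀ (pow_ne_zero 2 catSeries_ne_zero) h4

/-! ### Diagonal sums -/

/-- The series `∑ X^m f m`. -/
noncomputable def diagSum (f : ℕ → PowerSeries ℚ) : PowerSeries ℚ :=
  PowerSeries.mk fun j => ∑ m ∈ range (j + 1), coeff (j - m) (f m)

theorem diagSum_succ (f : ℕ → PowerSeries ℚ) :
    diagSum f = f 0 + X * diagSum fun m => f (m + 1) := by
  ext j
  rcases j with _ | j
  · simp [diagSum]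
  · rw [map_add, coeff_succ_X_mul, diagSum, coeff_mk, sum_range_succ', diagSum, coeff_mk, add_comm]
    simp

theorem diagSum_add (f g : ℕ → PowerSeries ℚ) :
    diagSum (fun m => f m + g m) = diagSum f + diagSum g := by
  ext j
  simp [diagSum, sum_add_distrib]

theorem diagSum_sub (f g : ℕ → PowerSeries ℚ) :
    diagSum (fun m => f m - g m) = diagSum f - diagSum g := by
  ext j
  simp [diagSum, sum_sub_distrib]

theorem diagSum_mul (c : PowerSeries ℚ) (f : ℕ → PowerSeries ℚ) :
    diagSum (fun m => c * f m) = c * diagSum f := by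
  ext j
  induction j generalizing f with
  | zero => simp [diagSum]
  | succ j ih =>
    rw [diagSum_succ, diagSum_succ f, map_add, coeff_succ_X_mul, ih, mul_add, map_add,
      mul_left_comm, coeff_succ_X_mul]

/-- The kernel `h` is geometric with ratio `A / P`, so multiplying the sum `T t` by `P` shifts it:
`P * T t = X * A * T (t + 1) + B * catSeries ^ (t + 1)`. The hypothesis on `κ` says that `κ *
catSeries ^ (t + 1)` solves the same equation. -/
theorem diagSum_convolution {N : ℕ → ℕ → PowerSeries ℚ} {h : ℕ → PowerSeries ℚ}
    {P A B κ : PowerSeries ℚ}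
    (hN : ∀ t, diagSum (fun m => N (m + t) m) = catSeries ^ (t + 1))
    (hP : constantCoeff P = 1) (h0 : P * h 0 = B) (hs : ∀ k, P * h (k + 1) = A * h k)
    (hκ : P * κ = X * A * catSeries * κ + B) (t : ℕ) :
    diagSum (fun m => ∑ b ∈ range (m + 1), N (m + t) b * h (m - b)) =
      κ * catSeries ^ (t + 1) := by
  refine eq_of_contraction hP (A := A) (H := fun t => B * catSeries ^ (t + 1))
    (F := fun t => diagSum (fun m => ∑ b ∈ range (m + 1), N (m + t) b * h (m - b)))
    (G := fun t => κ * catSeries ^ (t + 1)) ?_ ?_ t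
  · intro t
    have key : ∀ m, P * (∑ b ∈ range (m + 1 + 1), N (m + 1 + t) b * h (m + 1 - b)) =
        A * (∑ b ∈ range (m + 1), N (m + (t + 1)) b * h (m - b)) +
          B * N (m + 1 + t) (m + 1) := by
      intro m
      rw [sum_range_succ, mul_add, Nat.sub_self, ← h0, mul_sum, mul_sum]
      congr 1
      · refine sum_congr rfl fun b hb => ?_
        have : m + 1 - b = (m - b) + 1 := by have := mem_range.1 hb; omega
        rw [this, mul_left_comm, hs, show m + 1 + t = m + (t + 1) by ring]
        ring
      · ring
    rw [← diagSum_mul, diagSum_succ, ← hN t, diagSum_succ (fun m => N (m + t) m), funext key,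
      diagSum_add, diagSum_mul, diagSum_mul]
    simp only [zero_add, sum_range_one, Nat.sub_self]
    linear_combination N t 0 * h0
  · intro t
    linear_combination catSeries ^ (t + 1) * hκ

/-! ### Solving the recurrences for `N`, `SB` and `S` -/

section Counting

variable {N SB S : ℕ → ℕ → PowerSeries ℚ} {g0 g1 : ℕ → PowerSeries ℚ}

/-- Differencing the recurrence in `m` gives the ballot rule `hd`, which on diagonals is the
recurrence of the powers of `catSeries`. Assigning the value `1` at index `0` accounts for the
boundary `N m (m + 1) = 0`. -/
theorem diagSum_prefix (hN00 : N 0 0 = 1) (hNz : ∀ l m, l < m → N l m = 0)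
    (hNr : ∀ l m, m ≤ l + 1 → N (l + 1) m = ∑ b ∈ range (m + 1), N l b) (t : ℕ) :
    diagSum (fun m => N (m + t) m) = catSeries ^ (t + 1) := by
  have hd : ∀ l m, m ≤ l → N (l + 1) (m + 1) = N (l + 1) m + N l (m + 1) := by
    intro l m hm
    rw [hNr l (m + 1) (by omega), hNr l m (by omega), sum_range_succ]
  have := eq_of_recurrence
    (F := fun k => Nat.casesOn k 1 fun t => diagSum (fun m => N (m + t) m))
    (G := fun k => catSeries ^ k) (H := fun _ => 0) (by simp) ?_ ?_ (t + 1)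
  · exact this
  · intro k
    rcases k with _ | t
    · simp only [zero_add, add_zero]
      rw [diagSum_succ, hN00]
      congr 2
      refine congrArg _ (funext fun m => ?_)
      rw [hd m m le_rfl, hNz m (m + 1) (by omega), add_zero]
    · simp only [add_zero]
      rw [diagSum_succ, diagSum_succ (fun m => N (m + t) m)]
      have : (fun m => N (m + 1 + (t + 1)) (m + 1)) =
          fun m => N (m + (t + 1 + 1)) m + N (m + 1 + t) (m + 1) := by
        funext m
        have e : m + 1 + (t + 1) = (m + 1 + t) + 1 := by ring
        rw [e, hd _ _ (by omega)]
        congr 2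
        ring
      rw [this, diagSum_add, zero_add, zero_add, hNr t 0 (by omega), sum_range_one]
      ring
  · intro k
    rw [add_zero]
    exact catSeries_pow_recurrence k

/-- Same scheme as `diagSum_prefix`, now with initial value `0` and source `X * catSeries ^ (k + 3)`
from the convolution of `N` with `g0`. That `k * X * chooseSeries (k + 2)` absorbs this source
reduces to `chooseSeries_zero_mul`. -/
theorem one_sub_X_mul_diagSum_lower (hN00 : N 0 0 = 1) (hNz : ∀ l m, l < m → N l m = 0)
    (hNr : ∀ l m, m ≤ l + 1 → N (l + 1) m = ∑ b ∈ range (m + 1), N l b)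
    (h00 : g0 0 = 1) (h0s : ∀ k, (1 - X) * g0 (k + 1) = g0 k)
    (hSB0 : SB 0 0 = 0) (hSBz : ∀ l m, l < m → SB l m = 0)
    (hSBr : ∀ l m, m ≤ l + 1 → SB (l + 1) m =
      ∑ b ∈ range (m + 1), (SB l b + N l b * ∑ i ∈ range (m - b), g0 (i + 2))) (t : ℕ) :
    (1 - X) * diagSum (fun m => SB (m + t) m) =
      ((t : PowerSeries ℚ) + 1) * X * chooseSeries (t + 3) := by
  have hC := catSeries_eq
  have hP := diagSum_prefix hN00 hNz hNr
  have hQ := diagSum_convolution (h := fun k => g0 (k + 2)) (P := 1 - X) (A := 1) (B := g0 1)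
    (κ := catSeries ^ 2 * g0 1) hP (by simp) (h0s 1)
    (fun k => by rw [one_mul]; exact h0s (k + 2))
    (by linear_combination g0 1 * (1 + catSeries) * hC)
  have hd : ∀ l m, m ≤ l → SB (l + 1) (m + 1) = SB (l + 1) m + SB l (m + 1) +
      ∑ b ∈ range (m + 1), N l b * g0 (m - b + 2) := by
    intro l m hm
    rw [hSBr l (m + 1) (by omega), hSBr l m (by omega), sum_range_succ, Nat.sub_self, sum_range_zero,
      mul_zero, add_zero, add_right_comm, ← sum_add_distrib]
    congr 1
    refine sum_congr rfl fun b hb => ?_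
    have : m + 1 - b = (m - b) + 1 := by have := mem_range.1 hb; omega
    rw [this, sum_range_succ]
    ring
  have := eq_of_recurrence
    (F := fun k => (1 - X) * Nat.casesOn k 0 fun t => diagSum (fun m => SB (m + t) m))
    (G := fun k => (k : PowerSeries ℚ) * X * chooseSeries (k + 2))
    (H := fun k => X * catSeries ^ (k + 3)) (by simp) ?_ ?_ (t + 1)
  · simpa using this
  · intro k
    have hQ' : ∀ k, (1 - X) *
        diagSum (fun m => ∑ b ∈ range (m + 1), N (m + k) b * g0 (m - b + 2)) =
          catSeries ^ (k + 3) := by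
      intro k
      have := h0s 0
      rw [h00] at this
      rw [hQ]
      linear_combination catSeries ^ (k + 3) * this
    rcases k with _ | t
    · change (1 - X) * diagSum (fun m => SB (m + 0) m) =
        (1 - X) * 0 + X * ((1 - X) * diagSum fun m => SB (m + 1) m) + X * catSeries ^ (0 + 3)
      rw [diagSum_succ, hSB0, ← hQ']
      have : (fun m => SB (m + 1 + 0) (m + 1)) = fun m => SB (m + 1) m +
          ∑ b ∈ range (m + 1), N (m + 0) b * g0 (m - b + 2) := by
        funext m
        rw [add_zero, hd m m le_rfl, hSBz m (m + 1) (by omega), add_zero, add_zero]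
      rw [this, diagSum_add]
      ring
    · simp only
      rw [diagSum_succ, diagSum_succ (fun m => SB (m + t) m), ← hQ']
      have : (fun m => SB (m + 1 + (t + 1)) (m + 1)) = fun m => SB (m + (t + 1 + 1)) m +
          SB (m + 1 + t) (m + 1) +
          ∑ b ∈ range (m + 1), N (m + (t + 1)) b * g0 (m - b + 2) := by
        funext m
        have e : m + 1 + (t + 1) = (m + 1 + t) + 1 := by ring
        rw [e, hd _ _ (by omega)]
        have e1 : m + 1 + t = m + (t + 1) := by ring
        have e2 : m + 1 + t + 1 = m + (t + 1 + 1) := by ring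
        rw [e2, e1]
      rw [this, diagSum_add, diagSum_add, zero_add, zero_add, hSBr t 0 (by omega), sum_range_one]
      simp only [Nat.sub_self, sum_range_zero]
      ring
  · intro k
    have h1 := chooseSeries_recurrence (k + 2)
    have h2 := chooseSeries_zero_mul
    have h3 := chooseSeries_eq (k + 2)
    have h4 := chooseSeries_eq (k + 4)
    simp only [show k + 1 + 2 = k + 3 by ring, show k + 2 + 2 = k + 4 by ring] at h1 ⊢
    push_cast
    linear_combination ((k : PowerSeries ℚ) + 1) * X * h1 + X * h3 - X ^ 2 * h4 +
      X * catSeries ^ (k + 2) * h2 + X * catSeries ^ (k + 2) * chooseSeries 0 * hC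

/-- In `S - SB` the sums of `SB l b` over `b < m` cancel (`hD`), leaving an increment `E` that
depends on `N` alone. Its diagonal sums are multiples of `catSeries ^ (t + 1)`, so induction on `t`
telescopes a geometric sum. -/
theorem diagSum_difference (hN00 : N 0 0 = 1) (hNz : ∀ l m, l < m → N l m = 0)
    (hNr : ∀ l m, m ≤ l + 1 → N (l + 1) m = ∑ b ∈ range (m + 1), N l b)
    (h00 : g0 0 = 1) (h0s : ∀ k, (1 - X) * g0 (k + 1) = g0 k)
    (h10 : (1 - X) * g1 0 = 1) (h1s : ∀ k, (1 - 2 * X) * g1 (k + 1) = (1 - X) * g1 k)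
    (hSB0 : SB 0 0 = 0) (hSBz : ∀ l m, l < m → SB l m = 0)
    (hSBr : ∀ l m, m ≤ l + 1 → SB (l + 1) m =
      ∑ b ∈ range (m + 1), (SB l b + N l b * ∑ i ∈ range (m - b), g0 (i + 2)))
    (hS0 : S 0 0 = 0) (hSz : ∀ l m, l < m → S l m = 0)
    (hSr : ∀ l m, m ≤ l + 1 → S (l + 1) m = S l m +
      ∑ b ∈ range m, (SB l b + N l b * ∑ i ∈ range (m - b), g1 (i + 1))) (t : ℕ) :
    (1 - X) * (diagSum (fun m => S (m + t) m) - diagSum (fun m => SB (m + t) m)) =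
      X ^ 2 * catSeries ^ 5 * (catSeries ^ (t + 1) - 1) := by
  have hC := catSeries_eq
  have hP := diagSum_prefix hN00 hNz hNr
  have hv : (1 - X) * g0 1 = 1 := (h0s 0).trans h00
  have hQ0 := diagSum_convolution (h := fun k => g0 (k + 2)) (P := 1 - X) (A := 1) (B := g0 1)
    (κ := catSeries ^ 2 * g0 1) hP (by simp) (h0s 1)
    (fun k => by rw [one_mul]; exact h0s (k + 2))
    (by linear_combination g0 1 * (1 + catSeries) * hC)
  have hQ1 := diagSum_convolution (h := fun k => g1 (k + 1)) (P := 1 - 2 * X) (A := 1 - X) (B := 1)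
    (κ := catSeries ^ 3) hP (by simp) ((h1s 0).trans h10)
    (fun k => h1s (k + 1))
    (by
      linear_combination (catSeries ^ 2 + 1 + catSeries - X * catSeries ^ 2) * hC)
  set E : ℕ → ℕ → PowerSeries ℚ := fun l m =>
    ∑ b ∈ range m, N l b * ∑ i ∈ range (m - b), (g1 (i + 1) - g0 (i + 2)) with hE
  set Q : ℕ → ℕ → PowerSeries ℚ := fun l m =>
    ∑ b ∈ range (m + 1), N l b * g1 (m - b + 1) -
      ∑ b ∈ range (m + 1), N l b * g0 (m - b + 2) with hQ
  set q : PowerSeries ℚ := catSeries ^ 3 - catSeries ^ 2 * g0 1 with hq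
  have hQt : ∀ t, diagSum (fun m => Q (m + t) m) = q * catSeries ^ (t + 1) := by
    intro t
    rw [hQ, diagSum_sub, hQ0, hQ1]; ring
  have hEs : ∀ l m, E l (m + 1) = E l m + Q l m := by
    intro l m
    simp only [hE, hQ]
    rw [← sum_sub_distrib, sum_range_succ, sum_range_succ _ m, ← add_assoc, ← sum_add_distrib]
    congr 1
    · refine sum_congr rfl fun b hb => ?_
      have : m + 1 - b = (m - b) + 1 := by have := mem_range.1 hb; omega
      rw [this, sum_range_succ]
      ring
    · simp; ring
  have hEt : ∀ t, diagSum (fun m => E (m + t) m) = X * catSeries ^ 2 * q * catSeries ^ (t + 1) := by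
    intro t
    refine eq_of_contraction (P := 1) (A := 1) (F := fun t => diagSum (fun m => E (m + t) m))
      (G := fun t => X * catSeries ^ 2 * q * catSeries ^ (t + 1))
      (H := fun t => X * (q * catSeries ^ (t + 2))) (by simp) ?_ ?_ t
    · intro t
      rw [diagSum_succ, ← hQt (t + 1), one_mul, mul_one, ← mul_add, ← diagSum_add]
      have : E (0 + t) 0 = 0 := by simp [hE]
      rw [this, zero_add]
      congr 2
      funext m
      rw [hEs, show m + 1 + t = m + (t + 1) by ring]
    · intro t
      linear_combination X * catSeries ^ (t + 2) * q * hC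
  have hD : ∀ l m, m ≤ l + 1 → S (l + 1) m - SB (l + 1) m = (S l m - SB l m) + E l m := by
    intro l m hm
    rw [hSr l m hm, hSBr l m hm, sum_range_succ]
    simp only [hE, Nat.sub_self, sum_range_zero, mul_zero, add_zero, sum_add_distrib,
      sum_sub_distrib, mul_sub]
    ring
  rw [← diagSum_sub]
  have base : (1 - X) * (X * catSeries ^ 2 * q) = X ^ 2 * catSeries ^ 5 * (catSeries - 1) := by
    rw [hq]
    linear_combination (-X * catSeries ^ 4) * hv + X * catSeries ^ 4 * hC
  induction t with
  | zero =>
    have e : (fun m => S (m + 1 + 0) (m + 1) - SB (m + 1 + 0) (m + 1)) =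
        fun m => E (m + 0) m + Q (m + 0) m := by
      funext m
      rw [add_zero, hD m (m + 1) le_rfl, hSz m _ (by omega), hSBz m _ (by omega), hEs]
      simp
    rw [diagSum_succ, e, diagSum_add, hEt, hQt, hS0, hSB0]
    linear_combination base - (1 - X) * X * q * catSeries * hC
  | succ t ih =>
    have e : (fun m => S (m + (t + 1)) m - SB (m + (t + 1)) m) =
        fun m => (S (m + t) m - SB (m + t) m) + E (m + t) m := by
      funext m
      rw [← add_assoc, hD _ _ (by omega)]
    rw [e, diagSum_add, mul_add, ih, hEt]
    linear_combination catSeries ^ (t + 1) * base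

theorem coeff_eq_sum_of_one_sub_X_mul {F G : PowerSeries ℚ} (h : (1 - X) * F = G) (j : ℕ) :
    coeff j F = ∑ i ∈ range (j + 1), coeff i G := by
  induction j with
  | zero => simp [← h]
  | succ j ih =>
    rw [sum_range_succ, ← ih, ← h, sub_mul, one_mul, map_sub, coeff_succ_X_mul]
    ring

theorem coeff_diagSum_total (hN00 : N 0 0 = 1) (hNz : ∀ l m, l < m → N l m = 0)
    (hNr : ∀ l m, m ≤ l + 1 → N (l + 1) m = ∑ b ∈ range (m + 1), N l b)
    (h00 : g0 0 = 1) (h0s : ∀ k, (1 - X) * g0 (k + 1) = g0 k)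
    (h10 : (1 - X) * g1 0 = 1) (h1s : ∀ k, (1 - 2 * X) * g1 (k + 1) = (1 - X) * g1 k)
    (hSB0 : SB 0 0 = 0) (hSBz : ∀ l m, l < m → SB l m = 0)
    (hSBr : ∀ l m, m ≤ l + 1 → SB (l + 1) m =
      ∑ b ∈ range (m + 1), (SB l b + N l b * ∑ i ∈ range (m - b), g0 (i + 2)))
    (hS0 : S 0 0 = 0) (hSz : ∀ l m, l < m → S l m = 0)
    (hSr : ∀ l m, m ≤ l + 1 → S (l + 1) m = S l m +
      ∑ b ∈ range m, (SB l b + N l b * ∑ i ∈ range (m - b), g1 (i + 1))) (j t : ℕ) :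
    coeff j (diagSum (fun m => N (m + t) m) + X * diagSum (fun m => S (m + t) m)) =
      c j (t + 1) + ((t : ℚ) + 1) * ∑ i ∈ range (j - 1), ((2 * i + t + 3).choose i : ℚ) +
        ∑ i ∈ range (j - 2), (c i (t + 6) - c i 5) := by
  have hC := catSeries_eq
  have h1 := one_sub_X_mul_diagSum_lower hN00 hNz hNr h00 h0s hSB0 hSBz hSBr t
  have h2 := diagSum_difference hN00 hNz hNr h00 h0s h10 h1s hSB0 hSBz hSBr hS0 hSz hSr t
  have h3 : (1 - X) * diagSum (fun m => S (m + t) m) =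
      X * (((t + 1 : ℕ) : PowerSeries ℚ) * chooseSeries (t + 3) +
        X * (catSeries ^ (t + 6) - catSeries ^ 5)) := by
    push_cast
    linear_combination h1 + h2
  rw [map_add, diagSum_prefix hN00 hNz hNr, coeff_catSeries_pow _ _ (by omega), add_assoc]
  congr 1
  rcases j with _ | j
  · simp
  rw [coeff_succ_X_mul, coeff_eq_sum_of_one_sub_X_mul h3, sum_range_succ']
  simp only [coeff_succ_X_mul, coeff_zero_X_mul, add_zero, Nat.add_sub_cancel, map_add,
    sum_add_distrib]
  congr 1
  · rw [mul_sum]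
    refine sum_congr rfl fun i _ => ?_
    rw [← map_natCast (PowerSeries.C (R := ℚ)), coeff_C_mul, chooseSeries, coeff_mk, add_assoc]
    push_cast; rfl
  · rcases j with _ | j
    · simp
    · rw [sum_range_succ']
      simp only [coeff_succ_X_mul, coeff_zero_X_mul, add_zero, map_sub]
      refine sum_congr (by congr 1) fun i _ => ?_
      rw [coeff_catSeries_pow _ _ (by omega), coeff_catSeries_pow _ _ (by omega)]

end Counting

/-! ### Words with ordered and free letters -/

/-- The number of words of length `r` over `k` ordered letters and `ω` further letters, in which the
ordered letters appear in weakly increasing order. -/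
def shuffleCount (ω : ℕ) : ℕ → ℕ → ℕ
  | 0, _ => 1
  | r + 1, k => ω * shuffleCount ω r k + ∑ i ∈ range k, shuffleCount ω r (i + 1)

/-- The generating function of `shuffleCount` by length. -/
noncomputable def shuffleSeries (ω k : ℕ) : PowerSeries ℚ :=
  PowerSeries.mk fun r => (shuffleCount ω r k : ℚ)

theorem shuffleSeries_eq (ω k : ℕ) : shuffleSeries ω k =
    1 + X * ((ω : PowerSeries ℚ) * shuffleSeries ω k + ∑ i ∈ range k, shuffleSeries ω (i + 1)) := by
  ext r
  rcases r with _ | r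
  · simp [shuffleSeries, shuffleCount]
  · rw [map_add, coeff_succ_X_mul, map_add, ← map_natCast (PowerSeries.C (R := ℚ)), coeff_C_mul,
      map_sum]
    simp [shuffleSeries, shuffleCount, coeff_one]

theorem shuffleSeries_zero (ω : ℕ) : (1 - (ω : PowerSeries ℚ) * X) * shuffleSeries ω 0 = 1 := by
  have := shuffleSeries_eq ω 0
  rw [sum_range_zero] at this
  linear_combination this

theorem shuffleSeries_succ (ω k : ℕ) :
    (1 - ((ω : PowerSeries ℚ) + 1) * X) * shuffleSeries ω (k + 1) =
      (1 - (ω : PowerSeries ℚ) * X) * shuffleSeries ω k := by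
  have h1 := shuffleSeries_eq ω k
  have h2 := shuffleSeries_eq ω (k + 1)
  rw [sum_range_succ] at h2
  linear_combination h2 - h1

open Classical in
/-- The words of length `r` over `[lo, hi) ∪ W` whose letters outside `W` are weakly increasing. -/
noncomputable def shuffles (r lo hi : ℕ) (W : Finset ℕ) : Finset (Fin r → ℕ) :=
  (Fintype.piFinset fun _ => Ico lo hi ∪ W).filter fun w =>
    ∀ i j, i < j → w i ∉ W → w j ∉ W → w i ≤ w j

theorem mem_shuffles {r lo hi : ℕ} {W : Finset ℕ} {w : Fin r → ℕ} :
    w ∈ shuffles r lo hi W ↔ (∀ i, (lo ≤ w i ∧ w i < hi) ∨ w i ∈ W) ∧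
      ∀ i j, i < j → w i ∉ W → w j ∉ W → w i ≤ w j := by
  simp [shuffles]

theorem cons_mem_shuffles {r lo hi v : ℕ} {W : Finset ℕ} {w : Fin r → ℕ}
    (hv : v ∈ Ico lo hi ∪ W) :
    (Fin.cons v w : Fin (r + 1) → ℕ) ∈ shuffles (r + 1) lo hi W ↔
      w ∈ shuffles r (if v ∈ W then lo else v) hi W := by
  simp only [mem_shuffles, Fin.forall_fin_succ, Fin.cons_zero, Fin.cons_succ, Fin.succ_lt_succ_iff,
    Fin.succ_pos, Fin.not_lt_zero, true_imp_iff, false_imp_iff, true_and]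
  simp only [mem_union, mem_Ico] at hv
  by_cases h : v ∈ W
  · simp [h]
  · simp only [h, or_false] at hv
    simp only [h, not_false_eq_true, true_imp_iff, if_false]
    constructor
    · rintro ⟨⟨-, h1⟩, h2, h3⟩
      refine ⟨fun i => ?_, h3⟩
      by_cases hi : w i ∈ W
      · exact Or.inr hi
      · exact Or.inl ⟨h2 i hi, ((h1 i).resolve_right hi).2⟩
    · rintro ⟨h1, h3⟩
      refine ⟨⟨Or.inl hv, fun i => ?_⟩, fun i hi => ((h1 i).resolve_right hi).1, h3⟩
      exact (h1 i).imp_left fun h => ⟨hv.1.trans h.1, h.2⟩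

/-- Remove the first letter: a free letter leaves `lo` unchanged, an ordered letter `v` raises it to
`v`. The hypothesis `hW` makes the two alphabets disjoint. -/
theorem card_shuffles (r lo hi : ℕ) {W : Finset ℕ} (hW : ∀ u ∈ W, hi ≤ u) :
    (shuffles r lo hi W).card = shuffleCount W.card r (hi - lo) := by
  induction r generalizing lo with
  | zero =>
    rw [shuffleCount, card_eq_one]
    refine ⟨Fin.elim0, ?_⟩
    ext w
    simp [mem_shuffles, Subsingleton.elim w Fin.elim0]
  | succ r ih =>
    have hmap : ∀ w ∈ shuffles (r + 1) lo hi W, w 0 ∈ Ico lo hi ∪ W := by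
      intro w hw
      have := (mem_shuffles.1 hw).1 0
      simpa using this
    have hdisj : Disjoint (Ico lo hi) W := by
      rw [disjoint_left]
      intro v hv hvW
      have := hW v hvW
      have := (mem_Ico.1 hv).2
      omega
    rw [card_eq_sum_card_fiberwise hmap]
    have hf : ∀ v ∈ Ico lo hi ∪ W, ((shuffles (r + 1) lo hi W).filter fun w => w 0 = v).card =
        (shuffles r (if v ∈ W then lo else v) hi W).card := by
      intro v hv
      refine card_nbij' Fin.tail (fun w => Fin.cons v w) ?_ ?_ ?_ ?_
      · intro w hw
        obtain ⟨hw', rfl⟩ := mem_filter.1 hw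
        rw [← Fin.cons_self_tail w, cons_mem_shuffles hv] at hw'
        exact hw'
      · intro w hw
        exact mem_filter.2 ⟨(cons_mem_shuffles hv).2 hw, Fin.cons_zero _ _⟩
      · intro w hw
        obtain ⟨hw, rfl⟩ := mem_filter.1 hw
        exact Fin.cons_self_tail w
      · intro w _
        exact Fin.tail_cons _ _
    rw [sum_congr rfl hf, sum_union hdisj, add_comm, shuffleCount]
    congr 1
    · rw [sum_congr rfl fun v hv => by rw [if_pos hv, ih], sum_const, smul_eq_mul]
    · have : ∀ v ∈ Ico lo hi, (shuffles r (if v ∈ W then lo else v) hi W).card =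
          shuffleCount W.card r (hi - v) := by
        intro v hv
        rw [if_neg (disjoint_left.1 hdisj hv), ih]
      rw [sum_congr rfl this, sum_Ico_eq_sum_range, ← sum_range_reflect]
      refine sum_congr rfl fun i hi => ?_
      congr 1
      have := mem_range.1 hi
      omega

/-! ### Weakly increasing prefixes -/

open Classical in
/-- The weakly increasing inversion sequences of length `l + 1` with last entry `m`. -/
noncomputable def prefixes (l m : ℕ) : Finset (Fin (l + 1) → ℕ) :=
  (inversionSequences (l + 1)).filter fun a => Monotone a ∧ a (Fin.last l) = m

theorem mem_prefixes {l m : ℕ} {a : Fin (l + 1) → ℕ} :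
    a ∈ prefixes l m ↔ (∀ i, a i ≤ i) ∧ Monotone a ∧ a (Fin.last l) = m := by
  simp [prefixes, inversionSequences]

theorem prefixes_eq_empty {l m : ℕ} (h : l < m) : prefixes l m = ∅ := by
  ext a
  simp only [mem_prefixes, notMem_empty, iff_false]
  rintro ⟨h1, -, h2⟩
  have := h1 (Fin.last l)
  rw [h2, Fin.val_last] at this
  omega

theorem prefixes_zero_zero : prefixes 0 0 = {fun _ => 0} := by
  ext a
  simp only [mem_prefixes, mem_singleton]
  constructor
  · rintro ⟨h, -, -⟩
    funext i
    have := h i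
    omega
  · rintro rfl
    exact ⟨fun i => Nat.zero_le _, monotone_const, rfl⟩

theorem monotone_snoc_iff {l m : ℕ} {a : Fin (l + 1) → ℕ} :
    Monotone (Fin.snoc a m : Fin (l + 1 + 1) → ℕ) ↔ Monotone a ∧ a (Fin.last l) ≤ m := by
  constructor
  · intro h
    refine ⟨fun i j hij => ?_, ?_⟩
    · have := h (Fin.castSucc_le_castSucc_iff.2 hij)
      simpa using this
    · have := h (Fin.le_last (Fin.castSucc (Fin.last l)))
      simpa using this
  · rintro ⟨h1, h2⟩ i j hij
    induction j using Fin.lastCases with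
    | last =>
      rw [Fin.snoc_last]
      induction i using Fin.lastCases with
      | last => rw [Fin.snoc_last]
      | cast i =>
        rw [Fin.snoc_castSucc]
        exact (h1 (Fin.le_last i)).trans h2
    | cast j =>
      induction i using Fin.lastCases with
      | last => exact absurd hij (not_le.2 (Fin.castSucc_lt_last j))
      | cast i =>
        rw [Fin.snoc_castSucc, Fin.snoc_castSucc]
        exact h1 (Fin.castSucc_le_castSucc_iff.1 hij)

theorem snoc_mem_prefixes {l m : ℕ} (hm : m ≤ l + 1) {a : Fin (l + 1) → ℕ} :
    (Fin.snoc a m : Fin (l + 1 + 1) → ℕ) ∈ prefixes (l + 1) m ↔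
      a ∈ prefixes l (a (Fin.last l)) ∧ a (Fin.last l) ≤ m := by
  rw [mem_prefixes, mem_prefixes, monotone_snoc_iff, Fin.forall_fin_succ']
  simp [hm]
  tauto

theorem sum_prefixes_succ {R : Type*} [AddCommMonoid R] {l m : ℕ} (hm : m ≤ l + 1)
    (f : (Fin (l + 1 + 1) → ℕ) → R) :
    ∑ a ∈ prefixes (l + 1) m, f a =
      ∑ b ∈ range (m + 1), ∑ a ∈ prefixes l b, f (Fin.snoc a m) := by
  rw [sum_sigma']
  have hs : ∀ a ∈ prefixes (l + 1) m, (Fin.snoc (Fin.init a) m : Fin (l + 1 + 1) → ℕ) = a := by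
    intro a ha
    have := (mem_prefixes.1 ha).2.2
    conv_rhs => rw [← Fin.snoc_init_self a, this]
  refine sum_bij' (fun a _ => ⟨Fin.init a (Fin.last l), Fin.init a⟩) (fun p _ => Fin.snoc p.2 m)
    ?_ ?_ ?_ ?_ ?_
  · intro a ha
    have := ha
    rw [← hs a ha, snoc_mem_prefixes hm] at this
    exact mem_sigma.2 ⟨mem_range.2 (Nat.lt_succ_of_le this.2), this.1⟩
  · rintro ⟨b, a⟩ hp
    obtain ⟨hb, ha⟩ := mem_sigma.1 hp
    have hb := mem_range.1 hb
    obtain rfl : a (Fin.last l) = b := (mem_prefixes.1 ha).2.2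
    exact (snoc_mem_prefixes hm).2 ⟨ha, Nat.lt_succ_iff.1 hb⟩
  · intro a ha
    exact hs a ha
  · rintro ⟨b, a⟩ hp
    obtain ⟨hb, ha⟩ := mem_sigma.1 hp
    obtain rfl : a (Fin.last l) = b := (mem_prefixes.1 ha).2.2
    simp only [Fin.init_snoc]
  · intro a ha
    simp only [hs a ha]

/-! ### Next values and weights of prefixes -/

/-- The smallest entry of `a` that exceeds `x`. -/
noncomputable def nextValue {l : ℕ} (a : Fin (l + 1) → ℕ) (x : ℕ) : ℕ :=
  sInf {v | x < v ∧ ∃ i, a i = v}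

theorem nextValue_spec {l x : ℕ} {a : Fin (l + 1) → ℕ} (hx : x < a (Fin.last l)) :
    x < nextValue a x ∧ ∃ i, a i = nextValue a x :=
  Nat.sInf_mem (s := {v | x < v ∧ ∃ i, a i = v}) ⟨_, hx, _, rfl⟩

theorem nextValue_le {l x : ℕ} {a : Fin (l + 1) → ℕ} {i : Fin (l + 1)} (hx : x < a i) :
    nextValue a x ≤ a i :=
  Nat.sInf_le (s := {v | x < v ∧ ∃ i, a i = v}) ⟨hx, _, rfl⟩

theorem nextValue_eq {l x y : ℕ} {a : Fin (l + 1) → ℕ} {i : Fin (l + 1)} (hi : a i = y) (hx : x < y)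
    (h : ∀ j, x < a j → y ≤ a j) : nextValue a x = y := by
  apply le_antisymm (hi ▸ nextValue_le (hi ▸ hx))
  have : x < a i := hi ▸ hx
  obtain ⟨h1, j, hj⟩ : x < nextValue a x ∧ ∃ i, a i = nextValue a x :=
    Nat.sInf_mem (s := {v | x < v ∧ ∃ i, a i = v}) ⟨_, this, _, rfl⟩
  rw [← hj] at h1 ⊢
  exact h j h1

theorem nextValue_snoc_of_lt {l m x : ℕ} {a : Fin (l + 1) → ℕ} (hm : a (Fin.last l) ≤ m)
    (hx : x < a (Fin.last l)) :
    nextValue (Fin.snoc a m : Fin (l + 1 + 1) → ℕ) x = nextValue a x := by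
  obtain ⟨h1, i, hi⟩ := nextValue_spec hx
  refine nextValue_eq (i := i.castSucc) (by rw [Fin.snoc_castSucc, hi]) h1 ?_
  intro j hj
  induction j using Fin.lastCases with
  | last =>
    rw [Fin.snoc_last]
    exact (nextValue_le hx).trans hm
  | cast j =>
    rw [Fin.snoc_castSucc] at hj ⊢
    exact nextValue_le hj

theorem nextValue_snoc_of_le {l m x : ℕ} {a : Fin (l + 1) → ℕ} (ha : Monotone a)
    (hx : a (Fin.last l) ≤ x) (hm : x < m) :
    nextValue (Fin.snoc a m : Fin (l + 1 + 1) → ℕ) x = m := by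
  refine nextValue_eq (i := Fin.last _) (Fin.snoc_last _ _) hm ?_
  intro j hj
  induction j using Fin.lastCases with
  | last => rw [Fin.snoc_last]
  | cast j =>
    rw [Fin.snoc_castSucc] at hj
    have := ha (Fin.le_last j)
    omega

/-- The total weight of the continuations of a prefix that stay weakly below the next entry. -/
noncomputable def lowWeight {l : ℕ} (a : Fin (l + 1) → ℕ) : PowerSeries ℚ :=
  ∑ x ∈ range (a (Fin.last l)), shuffleSeries 0 (nextValue a x - x + 1)

/-- The total weight of the continuations of a prefix. -/
noncomputable def tailWeight {l : ℕ} (a : Fin (l + 1) → ℕ) : PowerSeries ℚ :=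
  ∑ x ∈ range (a (Fin.last l)), if nextValue a x = a (Fin.last l)
    then shuffleSeries 1 (a (Fin.last l) - x) else shuffleSeries 0 (nextValue a x - x + 1)

theorem sum_range_split {R : Type*} [AddCommMonoid R] {b m : ℕ} (h : b ≤ m) (f g k : ℕ → R)
    (h1 : ∀ x < b, f x = g x) (h2 : ∀ x, b ≤ x → x < m → f x = k (m - x - 1)) :
    ∑ x ∈ range m, f x = ∑ x ∈ range b, g x + ∑ i ∈ range (m - b), k i := by
  obtain ⟨d, rfl⟩ := Nat.exists_eq_add_of_le h
  rw [sum_range_add, Nat.add_sub_cancel_left, ← sum_range_reflect k]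
  congr 1
  · exact sum_congr rfl fun x hx => h1 x (mem_range.1 hx)
  · refine sum_congr rfl fun x hx => ?_
    have := mem_range.1 hx
    rw [h2 _ (by omega) (by omega)]
    congr 1
    omega

theorem lowWeight_snoc {l m : ℕ} {a : Fin (l + 1) → ℕ} (ha : Monotone a)
    (hm : a (Fin.last l) ≤ m) : lowWeight (Fin.snoc a m : Fin (l + 1 + 1) → ℕ) =
      lowWeight a + ∑ i ∈ range (m - a (Fin.last l)), shuffleSeries 0 (i + 2) := by
  rw [lowWeight, Fin.snoc_last]
  refine sum_range_split hm _ _ _ (fun x hx => ?_) fun x hx hxm => ?_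
  · rw [nextValue_snoc_of_lt hm hx]
  · rw [nextValue_snoc_of_le ha hx hxm]
    congr 1
    omega

theorem tailWeight_snoc_of_eq {l : ℕ} {a : Fin (l + 1) → ℕ} :
    tailWeight (Fin.snoc a (a (Fin.last l)) : Fin (l + 1 + 1) → ℕ) = tailWeight a := by
  rw [tailWeight, Fin.snoc_last]
  refine sum_congr rfl fun x hx => ?_
  rw [nextValue_snoc_of_lt le_rfl (mem_range.1 hx)]

/-- Once a larger entry is appended, the next value of each `x` below the old last entry is no
longer the maximum, so the old part contributes `lowWeight`. For the remaining `x` the next value is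
the new maximum `m`. -/
theorem tailWeight_snoc_of_lt {l m : ℕ} {a : Fin (l + 1) → ℕ} (ha : Monotone a)
    (hm : a (Fin.last l) < m) : tailWeight (Fin.snoc a m : Fin (l + 1 + 1) → ℕ) =
      lowWeight a + ∑ i ∈ range (m - a (Fin.last l)), shuffleSeries 1 (i + 1) := by
  rw [tailWeight, Fin.snoc_last]
  refine sum_range_split hm.le _ _ _ (fun x hx => ?_) fun x hx hxm => ?_
  · rw [nextValue_snoc_of_lt hm.le hx, if_neg]
    have := nextValue_le hx
    omega
  · rw [nextValue_snoc_of_le ha hx hxm, if_pos rfl]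
    congr 1
    omega

theorem sum_tailWeight_succ {l m : ℕ} (hm : m ≤ l + 1) :
    ∑ a ∈ prefixes (l + 1) m, tailWeight a = ∑ a ∈ prefixes l m, tailWeight a +
      ∑ b ∈ range m, (∑ a ∈ prefixes l b, lowWeight a +
        ((prefixes l b).card : PowerSeries ℚ) *
          ∑ i ∈ range (m - b), shuffleSeries 1 (i + 1)) := by
  rw [sum_prefixes_succ hm, sum_range_succ, add_comm]
  congr 1
  · refine sum_congr rfl fun a ha => ?_
    obtain rfl := (mem_prefixes.1 ha).2.2
    exact tailWeight_snoc_of_eq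
  · refine sum_congr rfl fun b hb => ?_
    rw [← nsmul_eq_mul, ← sum_const, ← sum_add_distrib]
    refine sum_congr rfl fun a ha => ?_
    obtain ⟨-, h, rfl⟩ := mem_prefixes.1 ha
    exact tailWeight_snoc_of_lt h (mem_range.1 hb)

theorem sum_lowWeight_succ {l m : ℕ} (hm : m ≤ l + 1) :
    ∑ a ∈ prefixes (l + 1) m, lowWeight a =
      ∑ b ∈ range (m + 1), (∑ a ∈ prefixes l b, lowWeight a +
        ((prefixes l b).card : PowerSeries ℚ) *
          ∑ i ∈ range (m - b), shuffleSeries 0 (i + 2)) := by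
  rw [sum_prefixes_succ hm]
  refine sum_congr rfl fun b hb => ?_
  rw [← nsmul_eq_mul, ← sum_const, ← sum_add_distrib]
  refine sum_congr rfl fun a ha => ?_
  obtain ⟨-, h, rfl⟩ := mem_prefixes.1 ha
  exact lowWeight_snoc h (Nat.lt_succ_iff.1 (mem_range.1 hb))

theorem coeff_diagSum_prefixes (j t : ℕ) :
    coeff j (diagSum (fun m => ((prefixes (m + t) m).card : PowerSeries ℚ)) +
        X * diagSum (fun m => ∑ a ∈ prefixes (m + t) m, tailWeight a)) =
      c j (t + 1) + ((t : ℚ) + 1) * ∑ i ∈ range (j - 1), ((2 * i + t + 3).choose i : ℚ) +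
        ∑ i ∈ range (j - 2), (c i (t + 6) - c i 5) := by
  refine coeff_diagSum_total (N := fun l m => ((prefixes l m).card : PowerSeries ℚ))
    (S := fun l m => ∑ a ∈ prefixes l m, tailWeight a)
    (SB := fun l m => ∑ a ∈ prefixes l m, lowWeight a) (g0 := shuffleSeries 0)
    (g1 := shuffleSeries 1) ?_ ?_ ?_ ?_ ?_ ?_ ?_ ?_ ?_ ?_ ?_ ?_ ?_ j t
  · simp [prefixes_zero_zero]
  · intro l m h
    simp [prefixes_eq_empty h]
  · intro l m h
    have := sum_prefixes_succ h fun _ => (1 : PowerSeries ℚ)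
    simpa using this
  · simpa using shuffleSeries_zero 0
  · intro k
    simpa using shuffleSeries_succ 0 k
  · simpa using shuffleSeries_zero 1
  · intro k
    have := shuffleSeries_succ 1 k
    push_cast at this
    linear_combination this
  · simp [prefixes_zero_zero, lowWeight]
  · intro l m h
    simp [prefixes_eq_empty h]
  · intro l m h
    exact sum_lowWeight_succ h
  · simp [prefixes_zero_zero, tailWeight]
  · intro l m h
    simp [prefixes_eq_empty h]
  · intro l m h
    exact sum_tailWeight_succ h

/-! ### Pattern avoidance and the first descent -/

theorem reduction_le_of_le {k : ℕ} {w : Fin k → ℕ} {i j : Fin k} (h : w i ≤ w j) :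
    reduction w i ≤ reduction w j := by
  refine card_le_card fun v hv => ?_
  simp only [mem_filter] at hv ⊢
  exact ⟨hv.1, hv.2.trans_le h⟩

theorem lt_of_reduction_lt {k : ℕ} {w : Fin k → ℕ} {i j : Fin k}
    (h : reduction w i < reduction w j) : w i < w j := by
  by_contra! h'
  exact absurd (reduction_le_of_le h') (not_le.2 h)

theorem reduction_eq_102 {w : Fin 3 → ℕ} :
    reduction w = ![1, 0, 2] ↔ w 1 < w 0 ∧ w 0 < w 2 := by
  constructor
  · intro h
    constructor <;> exact lt_of_reduction_lt (by simp [h])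
  · rintro ⟨h1, h2⟩
    have hu : univ.image w = {w 0, w 1, w 2} := by
      ext v; simp [Fin.exists_fin_succ, eq_comm]
    funext i
    rw [reduction, hu]
    have h3 := h1.trans h2
    fin_cases i
    · simp [filter_insert, filter_singleton, h1, h2.not_gt]
    · simp [filter_insert, filter_singleton, h1.not_gt, h3.not_gt]
    · simp [filter_insert, filter_singleton, h2, h3, h1.ne']

theorem reduction_eq_210 {w : Fin 3 → ℕ} :
    reduction w = ![2, 1, 0] ↔ w 2 < w 1 ∧ w 1 < w 0 := by
  constructor
  · intro h
    constructor <;> exact lt_of_reduction_lt (by simp [h])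
  · rintro ⟨h1, h2⟩
    have hu : univ.image w = {w 0, w 1, w 2} := by
      ext v; simp [Fin.exists_fin_succ, eq_comm]
    funext i
    rw [reduction, hu]
    have h3 := h1.trans h2
    fin_cases i
    · simp [filter_insert, filter_singleton, h2, h3, h1.ne']
    · simp [filter_insert, filter_singleton, h1, h2.not_gt]
    · simp [filter_insert, filter_singleton, h1.not_gt, h3.not_gt]

theorem avoids_three_iff {n : ℕ} {e : Fin n → ℕ} {p : Fin 3 → ℕ} :
    Avoids e p ↔ ∀ i j k, i < j → j < k → reduction ![e i, e j, e k] ≠ p := by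
  have hc : ∀ f : Fin 3 → Fin n, (fun i => e (f i)) = ![e (f 0), e (f 1), e (f 2)] := by
    intro f
    funext i
    fin_cases i <;> rfl
  constructor
  · intro h i j k hij hjk hr
    refine h ⟨![i, j, k], ?_, ?_⟩
    · rw [Fin.strictMono_iff_lt_succ]
      intro a
      fin_cases a
      · exact hij
      · exact hjk
    · rw [hc]
      exact hr
  · rintro h ⟨f, hf, hr⟩
    rw [hc] at hr
    exact h _ _ _ (hf (by decide)) (hf (by decide)) hr

theorem avoids_102_iff {n : ℕ} {e : Fin n → ℕ} :
    Avoids e ![1, 0, 2] ↔ ∀ i j k, i < j → j < k → ¬(e j < e i ∧ e i < e k) := by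
  simp only [avoids_three_iff, ne_eq, reduction_eq_102]
  rfl

theorem avoids_210_iff {n : ℕ} {e : Fin n → ℕ} :
    Avoids e ![2, 1, 0] ↔ ∀ i j k, i < j → j < k → ¬(e k < e j ∧ e j < e i) := by
  simp only [avoids_three_iff, ne_eq, reduction_eq_210]
  rfl

theorem entry_succ {n i : ℕ} (hi : i < n) (e : Fin n → ℕ) : entry e (i + 1) = e ⟨i, hi⟩ := by
  rw [entry, dif_pos ⟨by omega, by omega⟩]
  rfl

theorem entry_of_lt {n i : ℕ} (hi : n < i) (e : Fin n → ℕ) : entry e i = -1 := by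
  rw [entry, dif_neg (by omega)]

theorem prmx_mem {n : ℕ} (hn : 1 ≤ n) (e : Fin n → ℕ) :
    1 ≤ prmx e ∧ prmx e ≤ n ∧ entry e (prmx e + 1) < entry e (prmx e) := by
  have hmem : n ∈ {p : ℕ | 1 ≤ p ∧ p ≤ n ∧ entry e (p + 1) < entry e p} := by
    refine ⟨hn, le_rfl, ?_⟩
    obtain ⟨k, rfl⟩ := Nat.exists_eq_add_of_le' hn
    rw [entry_of_lt (Nat.lt_succ_self _), entry_succ (Nat.lt_succ_self _)]
    omega
  exact Nat.sInf_mem ⟨n, hmem⟩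

theorem prmx_eq_iff {n p : ℕ} (hp : 1 ≤ p) (hpn : p ≤ n) {e : Fin n → ℕ} :
    prmx e = p ↔ entry e (p + 1) < entry e p ∧
      ∀ q, 1 ≤ q → q < p → entry e q ≤ entry e (q + 1) := by
  constructor
  · rintro rfl
    refine ⟨(prmx_mem (hp.trans hpn) e).2.2, fun q hq hqp => ?_⟩
    by_contra! h
    exact Nat.notMem_of_lt_sInf hqp ⟨hq, by omega, h⟩
  · rintro ⟨h1, h2⟩
    have hmem : p ∈ {p : ℕ | 1 ≤ p ∧ p ≤ n ∧ entry e (p + 1) < entry e p} := ⟨hp, hpn, h1⟩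
    apply le_antisymm (Nat.sInf_le hmem)
    by_contra! h
    obtain ⟨h3, -, h5⟩ := prmx_mem (hp.trans hpn) e
    exact absurd (h2 _ h3 h) (not_le.2 h5)

theorem prmx_append {l r : ℕ} (a : Fin (l + 1) → ℕ) (w : Fin r → ℕ) :
    prmx (Fin.append a w) = l + 1 ↔ Monotone a ∧ ∀ h : 0 < r, w ⟨0, h⟩ < a (Fin.last l) := by
  rw [prmx_eq_iff (by omega) (by omega), Fin.monotone_iff_le_succ, and_comm]
  have hl : ∀ i (hi : i < l + 1), entry (Fin.append a w) (i + 1) = a ⟨i, hi⟩ := by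
    intro i hi
    rw [entry_succ (by omega)]
    exact congrArg _ (Fin.append_left a w ⟨i, hi⟩)
  congr! 1
  · constructor
    · intro h i
      have := h (i + 1) (by omega) (by omega)
      rw [hl _ (by omega), hl _ (by omega)] at this
      exact_mod_cast this
    · intro h q hq hql
      obtain ⟨i, rfl⟩ := Nat.exists_eq_add_of_le' hq
      rw [hl _ (by omega), hl _ (by omega)]
      exact_mod_cast h ⟨i, by omega⟩
  · rw [hl l (by omega)]
    rcases Nat.eq_zero_or_pos r with rfl | hr
    · rw [entry_of_lt (by omega)]
      simp only [lt_irrefl, IsEmpty.forall_iff, iff_true]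
      omega
    · rw [entry_succ (by omega)]
      have : Fin.append a w ⟨l + 1, by omega⟩ = w ⟨0, hr⟩ :=
        Fin.append_right a w ⟨0, hr⟩
      rw [this]
      simp only [hr, forall_true_left]
      exact Nat.cast_lt

/-! ### Decomposition at the first descent -/

/-- The condition on a continuation `w` of a weakly increasing prefix `a` with last entry `m`. -/
def IsTail {l r : ℕ} (a : Fin (l + 1) → ℕ) (m : ℕ) (w : Fin r → ℕ) : Prop :=
  (∀ i, w i ≤ m) ∧ (∀ h : 0 < r, w ⟨0, h⟩ < m) ∧
    (∀ i j, i < j → w i < m → w j < m → w i ≤ w j) ∧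
    ∀ i j k, i < j → w i < a k → w j ≤ a k

theorem rank_and_maxEntry_iff {n m t : ℕ} {e : Fin n → ℕ} :
    (rank e = (t : ℤ) ∧ maxEntry e = m) ↔ (prmx e = m + t + 1 ∧ maxEntry e = m) := by
  rw [rank]
  omega

theorem castAdd_lt_natAdd {n r : ℕ} (i : Fin n) (j : Fin r) : Fin.castAdd r i < Fin.natAdd n j := by
  rw [Fin.lt_def, Fin.val_castAdd, Fin.val_natAdd]
  omega

/-- The last prefix entry `m`, as the `1` of 102, bounds the suffix, and as the `2` of 210 orders
the letters below `m`; the other prefix entries, as the `1` of 102, give the last clause of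
`IsTail`. Conversely, any occurrence has at least two letters in the suffix. The inversion bound
there is automatic, since entries are at most `m` and positions exceed `m`. -/
theorem append_mem_avoiders {m t r : ℕ} {a : Fin (m + t + 1) → ℕ} {w : Fin r → ℕ} :
    (Fin.append a w ∈ avoiders102And210 (m + t + 1 + r) t ∧ maxEntry (Fin.append a w) = m) ↔
      a ∈ prefixes (m + t) m ∧ IsTail a m w := by
  have hmem : (Fin.append a w ∈ avoiders102And210 (m + t + 1 + r) t ∧
      maxEntry (Fin.append a w) = m) ↔ (∀ i, Fin.append a w i ≤ i) ∧
      Avoids (Fin.append a w) ![1, 0, 2] ∧ Avoids (Fin.append a w) ![2, 1, 0] ∧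
      prmx (Fin.append a w) = m + t + 1 ∧ maxEntry (Fin.append a w) = m := by
    rw [← rank_and_maxEntry_iff]
    simp [avoiders102And210, inversionSequences, and_assoc]
  rw [hmem, avoids_102_iff, avoids_210_iff, prmx_append, mem_prefixes]
  have hlast : ∀ i, i ≤ Fin.last (m + t) := Fin.le_last
  constructor
  · rintro ⟨hb, h102, h210, ⟨hmono, hw0⟩, hmax⟩
    have hle : ∀ i, Fin.append a w i ≤ m := fun i =>
      (le_sup (f := Fin.append a w) (mem_univ i)).trans hmax.le
    have hw : ∀ i, w i ≤ a (Fin.last _) := by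
      intro i
      by_contra! hi
      have hr : 0 < r := i.pos
      have h0 := hw0 hr
      have hne : (⟨0, hr⟩ : Fin r) < i := by
        rw [Fin.lt_def]
        refine Nat.pos_of_ne_zero fun h => ?_
        have : i = ⟨0, hr⟩ := Fin.ext h
        rw [this] at hi
        omega
      refine h102 (Fin.castAdd r (Fin.last _)) (Fin.natAdd _ ⟨0, hr⟩) (Fin.natAdd _ i) ?_ ?_ ?_
      · exact castAdd_lt_natAdd _ _
      · rw [Fin.lt_def] at hne ⊢; simpa using hne
      · rw [Fin.append_left, Fin.append_right, Fin.append_right]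
        exact ⟨h0, hi⟩
    have hm : a (Fin.last _) = m := by
      apply le_antisymm
      · have := hle (Fin.castAdd r (Fin.last _))
        rwa [Fin.append_left] at this
      · refine hmax.ge.trans ?_
        refine Finset.sup_le fun i _ => ?_
        refine Fin.addCases (fun i => ?_) (fun i => ?_) i
        · rw [Fin.append_left]
          exact hmono (hlast i)
        · rw [Fin.append_right]
          exact hw i
    rw [hm] at hw hw0
    refine ⟨⟨fun i => ?_, hmono, hm⟩, hw, hw0, fun i j hij hi hj => ?_, fun i j k hij hi => ?_⟩
    · have := hb (Fin.castAdd r i)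
      rwa [Fin.append_left] at this
    · by_contra! h
      refine h210 (Fin.castAdd r (Fin.last _)) (Fin.natAdd _ i) (Fin.natAdd _ j) ?_ ?_ ?_
      · exact castAdd_lt_natAdd _ _
      · rw [Fin.lt_def] at hij ⊢; simpa using hij
      · rw [Fin.append_left, Fin.append_right, Fin.append_right, hm]
        exact ⟨h, hi⟩
    · by_contra! h
      refine h102 (Fin.castAdd r k) (Fin.natAdd _ i) (Fin.natAdd _ j) ?_ ?_ ?_
      · exact castAdd_lt_natAdd _ _
      · rw [Fin.lt_def] at hij ⊢; simpa using hij
      · rw [Fin.append_left, Fin.append_right, Fin.append_right]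
        exact ⟨hi, h⟩
  · rintro ⟨⟨hb, hmono, hm⟩, hw, hw0, hinc, hgap⟩
    have hle : ∀ i, a i ≤ m := fun i => hm ▸ hmono (hlast i)
    have hmono' : ∀ i j : Fin (m + t + 1), Fin.castAdd r i < Fin.castAdd r j → a i ≤ a j := by
      intro i j h
      exact hmono (Fin.le_def.2 (by rw [Fin.lt_def] at h; simpa using h.le))
    have hltR : ∀ i j : Fin r, Fin.natAdd (m + t + 1) i < Fin.natAdd (m + t + 1) j → i < j := by
      intro i j h
      rw [Fin.lt_def] at h ⊢
      simpa using h
    have hno : ∀ (i : Fin r) (j : Fin (m + t + 1)),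
        ¬ Fin.natAdd (m + t + 1) i < Fin.castAdd r j := by
      intro i j h
      rw [Fin.lt_def] at h
      simp at h
      omega
    refine ⟨fun i => ?_, fun i j k hij hjk => ?_, fun i j k hij hjk => ?_, ⟨hmono, ?_⟩, ?_⟩
    · induction i using Fin.addCases with
      | left i => rw [Fin.append_left]; exact hb i
      | right i =>
        rw [Fin.append_right, Fin.val_natAdd]
        have := hw i
        omega
    · induction i using Fin.addCases with
      | left i =>
        induction j using Fin.addCases with
        | left j =>
          rw [Fin.append_left, Fin.append_left]
          have := hmono' i j hij
          omega
        | right j =>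
          induction k using Fin.addCases with
          | left k => exact absurd hjk (hno _ _)
          | right k =>
            rw [Fin.append_left, Fin.append_right, Fin.append_right]
            have := hgap j k i (hltR _ _ hjk)
            omega
      | right i =>
        induction j using Fin.addCases with
        | left j => exact absurd hij (hno _ _)
        | right j =>
          induction k using Fin.addCases with
          | left k => exact absurd hjk (hno _ _)
          | right k =>
            rw [Fin.append_right, Fin.append_right, Fin.append_right]
            have h1 := hinc i j (hltR _ _ hij)
            have h2 := hw k
            omega
    · induction i using Fin.addCases with
      | left i =>
        induction j using Fin.addCases with
        | left j =>
          rw [Fin.append_left, Fin.append_left]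
          have := hmono' i j hij
          omega
        | right j =>
          induction k using Fin.addCases with
          | left k => exact absurd hjk (hno _ _)
          | right k =>
            rw [Fin.append_left, Fin.append_right, Fin.append_right]
            have h1 := hinc j k (hltR _ _ hjk)
            have h2 := hle i
            omega
      | right i =>
        induction j using Fin.addCases with
        | left j => exact absurd hij (hno _ _)
        | right j =>
          induction k using Fin.addCases with
          | left k => exact absurd hjk (hno _ _)
          | right k =>
            rw [Fin.append_right, Fin.append_right, Fin.append_right]
            have h1 := hinc j k (hltR _ _ hjk)
            have h2 := hw i
            omega
    · rw [hm]
      exact hw0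
    · apply le_antisymm
      · refine Finset.sup_le fun i _ => ?_
        refine Fin.addCases (fun i => ?_) (fun i => ?_) i
        · rw [Fin.append_left]
          exact hle i
        · rw [Fin.append_right]
          exact hw i
      · have := le_sup (f := Fin.append a w) (mem_univ (Fin.castAdd r (Fin.last _)))
        rwa [Fin.append_left, hm] at this

/-- The continuations of the prefix `a` after a first descent to `x`. -/
noncomputable def tails {l : ℕ} (a : Fin (l + 1) → ℕ) (m r x : ℕ) : Finset (Fin r → ℕ) :=
  if nextValue a x = m then shuffles r x m {m} else shuffles r x (nextValue a x + 1) ∅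

theorem isTail_cons_iff {l m r x : ℕ} {a : Fin (l + 1) → ℕ} (ha : a ∈ prefixes l m)
    {w : Fin r → ℕ} :
    IsTail a m (Fin.cons x w : Fin (r + 1) → ℕ) ↔ x < m ∧ w ∈ tails a m r x := by
  obtain ⟨-, hmono, rfl⟩ := mem_prefixes.1 ha
  have h0 : ∀ h : 0 < r + 1, (Fin.cons x w : Fin (r + 1) → ℕ) ⟨0, h⟩ = x := fun _ => rfl
  have hle : ∀ i, a i ≤ a (Fin.last l) := fun i => hmono (Fin.le_last i)
  simp only [IsTail, h0, Nat.succ_pos, forall_true_left]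
  constructor
  · rintro ⟨h1, hx, h3, h4⟩
    refine ⟨hx, ?_⟩
    have h1' : ∀ i, w i ≤ a (Fin.last l) := fun i => by simpa using h1 i.succ
    have hx' : ∀ i, x ≤ w i := by
      intro i
      rcases (h1' i).lt_or_eq with h | h
      · have := h3 0 i.succ (Fin.succ_pos i)
        simp only [Fin.cons_zero, Fin.cons_succ] at this
        exact this hx h
      · omega
    have h3' : ∀ i j, i < j → w i < a (Fin.last l) → w j < a (Fin.last l) → w i ≤ w j := by
      intro i j hij
      have := h3 i.succ j.succ (Fin.succ_lt_succ_iff.2 hij)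
      simpa only [Fin.cons_succ] using this
    obtain ⟨hy, k, hk⟩ := nextValue_spec hx
    have hy' := nextValue_le hx
    have h4' : ∀ i, w i ≤ nextValue a x := by
      intro i
      have := h4 0 i.succ k (Fin.succ_pos i)
      simp only [Fin.cons_zero, Fin.cons_succ, hk] at this
      exact this hy
    rw [tails]
    split_ifs with h
    · rw [mem_shuffles]
      simp only [mem_singleton]
      refine ⟨fun i => ?_, fun i j hij hi hj => ?_⟩
      · rcases (h1' i).lt_or_eq with h | h
        · exact Or.inl ⟨hx' i, h⟩
        · exact Or.inr h
      · exact h3' i j hij (lt_of_le_of_ne (h1' i) hi) (lt_of_le_of_ne (h1' j) hj)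
    · rw [mem_shuffles]
      refine ⟨fun i => Or.inl ⟨hx' i, Nat.lt_succ_of_le (h4' i)⟩, fun i j hij _ _ => ?_⟩
      have hi := h4' i
      have hj := h4' j
      exact h3' i j hij (by omega) (by omega)
  · rintro ⟨hx, hw⟩
    obtain ⟨hy, k, hk⟩ := nextValue_spec hx
    have hy' := nextValue_le hx
    have key : (∀ i, x ≤ w i ∧ w i ≤ nextValue a x) ∧
        ∀ i j, i < j → w i < a (Fin.last l) → w j < a (Fin.last l) → w i ≤ w j := by
      rw [tails] at hw
      split_ifs at hw with h
      · obtain ⟨h1, h2⟩ := mem_shuffles.1 hw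
        simp only [mem_singleton] at h1 h2
        refine ⟨fun i => ?_, fun i j hij hi hj => h2 i j hij hi.ne hj.ne⟩
        have := h1 i
        omega
      · obtain ⟨h1, h2⟩ := mem_shuffles.1 hw
        simp only [notMem_empty, or_false, not_false_eq_true, forall_true_left] at h1 h2
        refine ⟨fun i => ?_, fun i j hij _ _ => h2 i j hij⟩
        have := h1 i
        omega
    obtain ⟨h1, h2⟩ := key
    -- All later letters are at least `x`, so the bound imposed by the first letter implies those
    -- imposed by the others.
    have hgap : ∀ i k, x < a k → w i ≤ a k := fun i k hk => (h1 i).2.trans (nextValue_le hk)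
    refine ⟨?_, hx, ?_, ?_⟩
    · rw [Fin.forall_fin_succ]
      refine ⟨hx.le, fun i => ?_⟩
      exact (h1 i).2.trans hy'
    · intro i j hij
      induction j using Fin.cases with
      | zero => exact absurd hij (Fin.not_lt_zero i)
      | succ j =>
        induction i using Fin.cases with
        | zero =>
          intro _ _
          exact (h1 j).1
        | succ i => exact h2 i j (Fin.succ_lt_succ_iff.1 hij)
    · intro i j k hij
      induction j using Fin.cases with
      | zero => exact absurd hij (Fin.not_lt_zero i)
      | succ j =>
        induction i using Fin.cases with
        | zero => exact hgap j k
        | succ i =>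
          intro hi
          exact hgap j k ((h1 i).1.trans_lt hi)

theorem card_tails {l m r x : ℕ} {a : Fin (l + 1) → ℕ} (hm : a (Fin.last l) = m)
    (hx : x < m) :
    ((tails a m r x).card : ℚ) = coeff r (if nextValue a x = a (Fin.last l)
      then shuffleSeries 1 (a (Fin.last l) - x) else shuffleSeries 0 (nextValue a x - x + 1)) := by
  rw [tails, hm]
  split_ifs with h
  · rw [card_shuffles _ _ _ (by simp), card_singleton, shuffleSeries, coeff_mk]
  · rw [card_shuffles _ _ _ (by simp), card_empty, shuffleSeries, coeff_mk,
      Nat.sub_add_comm (nextValue_spec (hm ▸ hx)).1.le]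

/-! ### Summation over the maximum and conclusion -/

theorem card_avoiders_fiber_zero (m t : ℕ) :
    ((avoiders102And210 (m + t + 1) t).filter fun e => maxEntry e = m).card =
      (prefixes (m + t) m).card := by
  congr 1
  ext a
  have h := append_mem_avoiders (a := a) (w := Fin.elim0)
  rw [Fin.append_elim0] at h
  have h' : IsTail a m (Fin.elim0 : Fin 0 → ℕ) :=
    ⟨fun i => i.elim0, fun h => absurd h (lt_irrefl 0), fun i => i.elim0, fun i => i.elim0⟩
  rw [mem_filter]
  simpa [h'] using h

theorem card_avoiders_fiber_succ (m t r : ℕ) :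
    ((avoiders102And210 (m + t + 1 + (r + 1)) t).filter fun e => maxEntry e = m).card =
      ∑ a ∈ prefixes (m + t) m, ∑ x ∈ range m, (tails a m r x).card := by
  simp_rw [← card_sigma]
  symm
  refine card_bij (fun p _ => Fin.append p.1 (Fin.cons p.2.1 p.2.2 : Fin (r + 1) → ℕ)) ?_ ?_ ?_
  · rintro ⟨a, x, w⟩ hp
    simp only [mem_sigma, mem_range] at hp
    exact mem_filter.2 (append_mem_avoiders.2 ⟨hp.1, (isTail_cons_iff hp.1).2 hp.2⟩)
  · rintro ⟨a, x, w⟩ _ ⟨a', x', w'⟩ _ h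
    obtain ⟨rfl, h2⟩ := Prod.ext_iff.1
      ((Fin.appendEquiv (α := ℕ) (m + t + 1) (r + 1)).injective 
        (a₁ := (a, Fin.cons x w)) (a₂ := (a', Fin.cons x' w')) h)
    obtain ⟨rfl, rfl⟩ := Fin.cons_injective2 (α := fun _ => ℕ) h2
    rfl
  · intro e he
    obtain ⟨⟨a, w⟩, rfl⟩ := (Fin.appendEquiv (α := ℕ) (m + t + 1) (r + 1)).surjective e
    have h := append_mem_avoiders.1 (mem_filter.1 he)
    refine ⟨⟨a, w 0, Fin.tail w⟩, ?_, ?_⟩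
    · rw [← Fin.cons_self_tail w, isTail_cons_iff h.1] at h
      simpa only [mem_sigma, mem_range] using h
    · simp only [Fin.cons_self_tail]
      rfl

/-- Here `s` is the suffix length; the factor `X` records the letter `x` right after the descent,
and the constant term is the empty suffix. -/
theorem card_avoiders_fiber (m t s : ℕ) :
    (((avoiders102And210 (m + t + 1 + s) t).filter fun e => maxEntry e = m).card : ℚ) =
      coeff s (((prefixes (m + t) m).card : PowerSeries ℚ) +
        X * ∑ a ∈ prefixes (m + t) m, tailWeight a) := by
  rw [← map_natCast (PowerSeries.C (R := ℚ))]
  rcases s with _ | r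
  · rw [add_zero, card_avoiders_fiber_zero]
    simp
  · rw [card_avoiders_fiber_succ, map_add, coeff_succ_X_mul, coeff_C, if_neg (by omega), zero_add,
      map_sum]
    push_cast
    refine sum_congr rfl fun a ha => ?_
    have hm := (mem_prefixes.1 ha).2.2
    rw [tailWeight, map_sum, hm]
    refine sum_congr rfl fun x hx => ?_
    rw [card_tails hm (mem_range.1 hx), hm]

theorem card_avoiders (j t : ℕ) : ((avoiders102And210 (j + t + 1) t).card : ℚ) =
    coeff j (diagSum (fun m => ((prefixes (m + t) m).card : PowerSeries ℚ)) +
        X * diagSum (fun m => ∑ a ∈ prefixes (m + t) m, tailWeight a)) := by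
  -- The first descent position is `maxEntry e + t + 1` and is at most `j + t + 1`, so the maximum
  -- is at most `j`.
  have hmap : ∀ e ∈ avoiders102And210 (j + t + 1) t, maxEntry e ∈ range (j + 1) := by
    intro e he
    simp only [avoiders102And210, mem_filter] at he
    have hr := he.2.2.2
    have := (prmx_mem (by omega) e).2.1
    rw [rank] at hr
    rw [mem_range]
    omega
  rw [card_eq_sum_card_fiberwise hmap, ← diagSum_mul, ← diagSum_add, diagSum, coeff_mk]
  push_cast
  refine sum_congr rfl fun m hm => ?_
  rw [← card_avoiders_fiber]
  obtain ⟨s, rfl⟩ := Nat.exists_eq_add_of_le (Nat.lt_succ_iff.1 (mem_range.1 hm))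
  have : m + s + t + 1 = m + t + 1 + s := by ring
  rw [Nat.add_sub_cancel_left, this]

end InvSeq

theorem mainTheorem11 :
    (∀ j k : ℕ, 1 ≤ k →
      InvSeq.c j k = ((PowerSeries.coeff j (PowerSeries.catalanSeries ^ k) : ℕ) : ℚ)) ∧
    (∀ n t : ℕ, 2 ≤ n → t ≤ n - 1 →
      ((InvSeq.avoiders102And210 n t).card : ℚ) =
        InvSeq.c (n - t - 1) (t + 1)
          + ((t : ℚ) + 1) *
              ∑ i ∈ Finset.range (n - t - 2), ((2 * i + t + 3).choose i : ℚ)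
          + ∑ i ∈ Finset.range (n - t - 3), (InvSeq.c i (t + 6) - InvSeq.c i 5)) := by
  refine ⟨fun j k hk => ?_, fun n t hn ht => ?_⟩
  · rw [← InvSeq.coeff_catSeries_pow j k hk, InvSeq.catSeries, ← map_pow, PowerSeries.coeff_map]
    rfl
  · obtain ⟨j, rfl⟩ : ∃ j, n = j + t + 1 := ⟨n - t - 1, by omega⟩
    rw [InvSeq.card_avoiders, InvSeq.coeff_diagSum_prefixes]
    have e1 : j + t + 1 - t - 1 = j := by omega
    have e2 : j + t + 1 - t - 2 = j - 1 := by omega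
    have e3 : j + t + 1 - t - 3 = j - 2 := by omega
    rw [e1, e2, e3]
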